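/- Let $R$ be an associative ring with identity and let $\mathcal X$ be a class of $R$-modules. Put $\mathcal X^{\perp}=\{E : \mathrm{Ext}^1(B,E)=0 \text{ for all } B\in\mathcal X\}$ (the $\mathcal X$-injective modules) and ${}^{\perp}\mathcal X=\{P : \mathrm{Ext}^1(P,B)=0\text{ for all }B\in\mathcal X\}$ (the $\mathcal X$-projective modules), and assume that $\mathcal X^{\perp}\subseteq\mathcal X$ and ${}^{\perp}\mathcal X\subseteq\mathcal X$. Let $C(\mathcal X^{*})$ be the class of complexes of $R$-modules all of whose terms lie in $\mathcal X$. Let $C(\mathcal X\text{-injective})$ (respectively $C(\mathcal X\text{-projective})$) be the class of complexes $C$ with $\mathrm{Ext}^1(Z,C)=0$ (respectively $\mathrm{Ext}^1(C,Z)=0$) for all $Z\in C(\mathcal X^{*})$, where $\mathrm{Ext}$ is taken in the category of complexes. For a class $\mathcal Y$ of modules let $\varepsilon_{\mathcal Y}$ be the class of exact complexes all of whose kernels lie in $\mathcal Y$. For a class $\mathcal F$ of objects, an $\mathcal F$-preenvelope of $M$ is a morphism $M\to F$ with $F\in\mathcal F$ through which every morphism from $M$ to an object of $\mathcal F$ factors;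 an $\mathcal F$-precover $F\to M$ is defined dually. A complex $Y$ (written cohomologically) is left bounded if $Y^n=0$ for all $n\ll 0$, and right bounded if $Y^n=0$ for all $n\gg 0$. (i) Suppose that $\mathcal X$ is closed under direct sums and extensions and is special precovering and special preenveloping, i.e. for every module $M$ there are short exact sequences $0\to K\to A\to M\to 0$ and $0\to M\to A'\to L\to 0$ with $A,A'\in\mathcal X$, $K\in\mathcal X^{\perp}$ and $L\in{}^{\perp}\mathcal X$. Then every left bounded complex has a monic $C(\mathcal X\text{-injective})$-preenvelope $Y\to E$ with $E$ exact, and every right bounded complex has an epic $C(\mathcal X\text{-projective})$-precover $P\to Y$ with $P$ exact. (ii) Suppose that $(\mathcal X,\mathcal X^{\perp})$ is a complete cotorsion pair, i.e. $\mathcal X={}^{\perp}(\mathcal X^{\perp})$ and for every module $M$ there are short exact sequences $0\to B\to A\to M\to 0$ and $0\to M\to B'\to A'\to 0$ with $A,A'\in\mathcal X$ and $B,B'\in\mathcal X^{\perp}$, and that $C(\mathcal X^{*})$ is closed under inverse limits (over directed index sets). Then every complex $Y$ has a monic $C(\mathcal X\text{-injective})$-preenvelope $Y\to E$ with $E$ exact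 and $E\in\varepsilon_{\mathcal X^{\perp}}$, and an epic $C(\mathcal X\text{-projective})$-precover $P\to Y$ with $P$ exact and $P\in\varepsilon_{{}^{\perp}\mathcal X}$. -/

import Mathlib

open CategoryTheory CategoryTheory.Limits CategoryTheory.Abelian

universe u v w

noncomputable section

namespace XComplex

section Abelian

variable {C : Type w} [Category.{v} C] [Abelian C]

/-- `Ext¹(A, B) = 0`. -/
def ExtOneVanishes (A B : C) : Prop :=
  letI := HasExt.standard C
  Subsingleton (Ext.{max w v} A B 1)

/-- `P^⊥`: the objects `B` with `Ext¹(A, B) = 0` for all `A` in `P`. -/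
def rightOrth (P : ObjectProperty C) : ObjectProperty C :=
  fun B => ∀ A : C, P A → ExtOneVanishes A B

/-- `^⊥P`: the objects `A` with `Ext¹(A, B) = 0` for all `B` in `P`. -/
def leftOrth (P : ObjectProperty C) : ObjectProperty C :=
  fun A => ∀ B : C, P B → ExtOneVanishes A B

/-- `φ : M ⟶ F` is a `P`-preenvelope of `M`. -/
structure IsPreenvelope (P : ObjectProperty C) {M F : C} (φ : M ⟶ F) : Prop where
  mem : P F
  factors : ∀ (F' : C), P F' → ∀ f : M ⟶ F', ∃ g : F ⟶ F', φ ≫ g = f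

/-- `φ : F ⟶ M` is a `P`-precover of `M`. -/
structure IsPrecover (P : ObjectProperty C) {F M : C} (φ : F ⟶ M) : Prop where
  mem : P F
  factors : ∀ (F' : C), P F' → ∀ f : F' ⟶ M, ∃ g : F' ⟶ F, g ≫ φ = f

/-- Every object `M` has a special `P`-precover: there is a short exact sequence
`0 ⟶ K ⟶ A ⟶ M ⟶ 0` with `A` in `P` and `K` in `P^⊥`. -/
def IsSpecialPrecovering (P : ObjectProperty C) : Prop :=
  ∀ M : C, ∃ (K A : C) (i : K ⟶ A) (p : A ⟶ M) (h : i ≫ p = 0),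
    (ShortComplex.mk i p h).ShortExact ∧ P A ∧ rightOrth P K

/-- Every object `M` has a special `P`-preenvelope: there is a short exact sequence
`0 ⟶ M ⟶ A ⟶ L ⟶ 0` with `A` in `P` and `L` in `^⊥P`. -/
def IsSpecialPreenveloping (P : ObjectProperty C) : Prop :=
  ∀ M : C, ∃ (A L : C) (i : M ⟶ A) (p : A ⟶ L) (h : i ≫ p = 0),
    (ShortComplex.mk i p h).ShortExact ∧ P A ∧ leftOrth P L

/-- `(P, Q)` is a complete cotorsion pair: `P = ^⊥Q`, `Q = P^⊥`, and every object `M` fits into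
short exact sequences `0 ⟶ B ⟶ A ⟶ M ⟶ 0` and `0 ⟶ M ⟶ B' ⟶ A' ⟶ 0` with
`A, A'` in `P` and `B, B'` in `Q`. -/
structure IsCompleteCotorsionPair (P Q : ObjectProperty C) : Prop where
  left_eq : P = leftOrth Q
  right_eq : Q = rightOrth P
  enough_projectives : ∀ M : C, ∃ (B A : C) (i : B ⟶ A) (p : A ⟶ M) (h : i ≫ p = 0),
    (ShortComplex.mk i p h).ShortExact ∧ P A ∧ Q B
  enough_injectives : ∀ M : C, ∃ (B A : C) (i : M ⟶ B) (p : B ⟶ A) (h : i ≫ p = 0),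
    (ShortComplex.mk i p h).ShortExact ∧ P A ∧ Q B

/-- `P` is closed under (small, possibly infinite) direct sums. -/
def IsClosedUnderDirectSums (P : ObjectProperty C) : Prop :=
  ∀ ι : Type v, P.IsClosedUnderColimitsOfShape (Discrete ι)

/-- `P` is closed under inverse limits of inverse systems indexed by (nonempty, small)
directed sets. -/
def IsClosedUnderInverseLimits (P : ObjectProperty C) : Prop :=
  ∀ (J : Type v) [Preorder J] [IsDirected J (· ≤ ·)] [Nonempty J],
    P.IsClosedUnderLimitsOfShape Jᵒᵖ

end Abelian

section Modules

variable {R : Type u} [Ring R]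

/-- The class of `X`-injective modules `E`: `Ext¹(B, E) = 0` for all `B` in `X`. -/
abbrev XInjective (X : ObjectProperty (ModuleCat.{u} R)) : ObjectProperty (ModuleCat.{u} R) :=
  rightOrth X

/-- The class of `X`-projective modules `P`: `Ext¹(P, B) = 0` for all `B` in `X`. -/
abbrev XProjective (X : ObjectProperty (ModuleCat.{u} R)) : ObjectProperty (ModuleCat.{u} R) :=
  leftOrth X

/-- `C(X*)`: the complexes all of whose terms are in `X`. -/
def CStar (X : ObjectProperty (ModuleCat.{u} R)) :
    ObjectProperty (CochainComplex (ModuleCat.{u} R) ℤ) :=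
  fun K => ∀ n : ℤ, X (K.X n)

/-- `C(X-injective)`: the complexes `K` with `Ext¹(Z, K) = 0` for every `Z` in `C(X*)`, where
`Ext` is computed in the abelian category of complexes. -/
abbrev CInjective (X : ObjectProperty (ModuleCat.{u} R)) :
    ObjectProperty (CochainComplex (ModuleCat.{u} R) ℤ) :=
  rightOrth (CStar X)

/-- `C(X-projective)`: the complexes `K` with `Ext¹(K, Z) = 0` for every `Z` in `C(X*)`. -/
abbrev CProjective (X : ObjectProperty (ModuleCat.{u} R)) :
    ObjectProperty (CochainComplex (ModuleCat.{u} R) ℤ) :=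
  leftOrth (CStar X)

/-- `ε_Y`: the exact complexes all of whose kernels (cycles) are in `Y`. -/
def EpsilonClass (Y : ObjectProperty (ModuleCat.{u} R)) :
    ObjectProperty (CochainComplex (ModuleCat.{u} R) ℤ) :=
  fun K => K.Acyclic ∧ ∀ n : ℤ, Y (K.cycles n)

/-- Left bounded: `⋯ ⟶ 0 ⟶ K^m ⟶ K^{m+1} ⟶ ⋯`. -/
def IsLeftBounded (K : CochainComplex (ModuleCat.{u} R) ℤ) : Prop :=
  ∃ m : ℤ, ∀ n < m, IsZero (K.X n)

/-- Right bounded: `⋯ ⟶ K^{m-1} ⟶ K^m ⟶ 0 ⟶ ⋯`. -/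
def IsRightBounded (K : CochainComplex (ModuleCat.{u} R) ℤ) : Prop :=
  ∃ m : ℤ, ∀ n > m, IsZero (K.X n)

end Modules

end XComplex

end

/-! If `Y` embeds in `E`, with `E` in `C(X-injective)` and cokernel in `C(X*)`, then vanishing of
`Ext¹` extends every map from `Y` to a `C(X-injective)` complex over `E`, so `Y ⟶ E` is a
preenvelope. To build `E`, embed each term of `Y` in an `X`-injective module `B n` with cokernel in
`X`, and take the contractible complex with terms `B n ⊞ B (n + 1)`. A chain map into it is an
arbitrary family of maps `Y.X n ⟶ B n`. Hence the embeddings assemble to a chain map, and membership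
in `C(X-injective)` is checked degreewise. In degree `n` the cokernel is an extension of an object
of `X` by `B (n + 1)`, so it lies in `X`. Precovers are dual. This is `exists_mono_preenvelope` and
`exists_epi_precover`.

In (i) the required embeddings come from special precovers by a pullback along an injective
presentation (`exists_mono_rightOrth`), and dually for the quotients. In (ii) the embeddings are
part of the cotorsion pair. For the quotients, every module is a directed inverse limit of injective
modules, and injectives lie in `X`; so closure under inverse limits forces `X` to contain all
modules (`prop_of_isClosedUnderInverseLimits`), and any projective presentation serves. -/

noncomputable section

namespace XComplex

/-! ### `Ext¹`-orthogonality and special approximations -/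

section Abelian

variable {C : Type w} [Category.{v} C] [Abelian C]

lemma ExtOneVanishes.exists_extension {S : ShortComplex C} (hS : S.ShortExact) {F : C}
    (h : ExtOneVanishes S.X₃ F) (f : S.X₁ ⟶ F) : ∃ g : S.X₂ ⟶ F, S.f ≫ g = f := by
  let := HasExt.standard C
  have : Subsingleton (Ext.{max w v} S.X₃ F 1) := h
  obtain ⟨x, hx⟩ := Ext.contravariant_sequence_exact₁ hS F (Ext.mk₀ f) (n₁ := 1) rfl
    (Subsingleton.elim _ _)
  obtain ⟨g, rfl⟩ := Ext.addEquiv₀.symm.surjective x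
  refine ⟨g, Ext.addEquiv₀.symm.injective ?_⟩
  simpa using hx

lemma ExtOneVanishes.exists_lift {S : ShortComplex C} (hS : S.ShortExact) {F : C}
    (h : ExtOneVanishes F S.X₁) (f : F ⟶ S.X₃) : ∃ g : F ⟶ S.X₂, g ≫ S.g = f := by
  let := HasExt.standard C
  have : Subsingleton (Ext.{max w v} F S.X₁ 1) := h
  obtain ⟨x, hx⟩ := Ext.covariant_sequence_exact₃ F hS (Ext.mk₀ f) (n₁ := 1) rfl
    (Subsingleton.elim _ _)
  obtain ⟨g, rfl⟩ := Ext.addEquiv₀.symm.surjective x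
  refine ⟨g, Ext.addEquiv₀.symm.injective ?_⟩
  simpa using hx

lemma extOneVanishes_of_injective (A I : C) [Injective I] : ExtOneVanishes A I := by
  let := HasExt.standard C
  exact Ext.subsingleton_of_injective A I 0

lemma extOneVanishes_of_projective (P B : C) [Projective P] : ExtOneVanishes P B := by
  let := HasExt.standard C
  exact Ext.subsingleton_of_projective P B 0

lemma rightOrth_of_shortExact (P : ObjectProperty C) {S : ShortComplex C} (hS : S.ShortExact)
    (h₁ : rightOrth P S.X₁) (h₃ : rightOrth P S.X₃) : rightOrth P S.X₂ := by
  intro A hA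
  let := HasExt.standard C
  have h₁ : Subsingleton (Ext.{max w v} A S.X₁ 1) := h₁ A hA
  have h₃ : Subsingleton (Ext.{max w v} A S.X₃ 1) := h₃ A hA
  refine subsingleton_of_forall_eq (0 : Ext.{max w v} A S.X₂ 1) fun x => ?_
  obtain ⟨y, rfl⟩ := Ext.covariant_sequence_exact₂ A hS x (Subsingleton.elim _ _)
  rw [Subsingleton.elim y 0, Ext.zero_comp]

lemma leftOrth_of_shortExact (P : ObjectProperty C) {S : ShortComplex C} (hS : S.ShortExact)
    (h₁ : leftOrth P S.X₁) (h₃ : leftOrth P S.X₃) : leftOrth P S.X₂ := by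
  intro B hB
  let := HasExt.standard C
  have h₁ : Subsingleton (Ext.{max w v} S.X₁ B 1) := h₁ B hB
  have h₃ : Subsingleton (Ext.{max w v} S.X₃ B 1) := h₃ B hB
  refine subsingleton_of_forall_eq (0 : Ext.{max w v} S.X₂ B 1) fun x => ?_
  obtain ⟨y, rfl⟩ := Ext.contravariant_sequence_exact₂ hS B x (Subsingleton.elim _ _)
  rw [Subsingleton.elim y 0, Ext.comp_zero]

lemma rightOrth_of_iso (P : ObjectProperty C) {B B' : C} (e : B ≅ B') (h : rightOrth P B) :
    rightOrth P B' := by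
  intro A hA
  let := HasExt.standard C
  have h : Subsingleton (Ext.{max w v} A B 1) := h A hA
  refine subsingleton_of_forall_eq (0 : Ext.{max w v} A B' 1) fun x => ?_
  have hx : (x.comp (Ext.mk₀ e.inv) (add_zero 1)).comp (Ext.mk₀ e.hom) (add_zero 1) = x := by
    simp
  rw [← hx, Subsingleton.elim (x.comp (Ext.mk₀ e.inv) (add_zero 1)) 0, Ext.zero_comp]

lemma leftOrth_of_iso (P : ObjectProperty C) {A A' : C} (e : A ≅ A') (h : leftOrth P A) :
    leftOrth P A' := by
  intro B hB
  let := HasExt.standard C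
  have h : Subsingleton (Ext.{max w v} A B 1) := h B hB
  refine subsingleton_of_forall_eq (0 : Ext.{max w v} A' B 1) fun x => ?_
  have hx : (Ext.mk₀ e.inv).comp ((Ext.mk₀ e.hom).comp x (zero_add 1)) (zero_add 1) = x := by
    simp
  rw [← hx, Subsingleton.elim ((Ext.mk₀ e.hom).comp x (zero_add 1)) 0, Ext.comp_zero]

/-- The kernel sequence of `p` pulls back along a cartesian square. -/
lemma exists_shortExact_of_isPullback {S : ShortComplex C} (hS : S.ShortExact) {P Y : C}
    {a : P ⟶ S.X₂} {b : P ⟶ Y} {y : Y ⟶ S.X₃} (h : IsPullback a b S.g y) :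
    ∃ (j : S.X₁ ⟶ P) (wj : j ≫ b = 0), j ≫ a = S.f ∧ (ShortComplex.mk j b wj).ShortExact := by
  have := hS.mono_f
  have := hS.epi_g
  have hb : Epi b :=
    (MorphismProperty.epimorphisms C).of_isPullback h
      (MorphismProperty.epimorphisms.infer_property S.g)
  refine ⟨h.lift S.f 0 (by simp), by simp, by simp, ?_⟩
  have hj : Mono (h.lift S.f (0 : S.X₁ ⟶ Y) (by simp)) := by
    have : Mono (h.lift S.f (0 : S.X₁ ⟶ Y) (by simp) ≫ a) := by simpa using hS.mono_f
    exact mono_of_mono _ a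
  refine ShortComplex.ShortExact.mk' (ShortComplex.exact_of_f_is_kernel _ ?_) hj hb
  refine KernelFork.IsLimit.ofι' _ _ fun {A} k hk => ⟨hS.exact.lift (k ≫ a) ?_, ?_⟩
  · rw [Category.assoc, h.w, reassoc_of% hk, zero_comp]
  · apply h.hom_ext
    · simp
    · simpa using hk.symm

/-- The cokernel sequence of `i` is pushed out along a cocartesian square. -/
lemma exists_shortExact_of_isPushout {S : ShortComplex C} (hS : S.ShortExact) {Q Y : C}
    {a : S.X₂ ⟶ Q} {b : Y ⟶ Q} {y : S.X₁ ⟶ Y} (h : IsPushout S.f y a b) :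
    ∃ (q : Q ⟶ S.X₃) (wq : b ≫ q = 0), a ≫ q = S.g ∧ (ShortComplex.mk b q wq).ShortExact := by
  have := hS.mono_f
  have := hS.epi_g
  have hb : Mono b :=
    (MorphismProperty.monomorphisms C).of_isPushout h.flip
      (MorphismProperty.monomorphisms.infer_property S.f)
  refine ⟨h.desc S.g 0 (by simp), by simp, by simp, ?_⟩
  have hj : Epi (h.desc S.g (0 : Y ⟶ S.X₃) (by simp)) := by
    have : Epi (a ≫ h.desc S.g (0 : Y ⟶ S.X₃) (by simp)) := by simpa using hS.epi_g
    exact epi_of_epi a _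
  refine ShortComplex.ShortExact.mk' (ShortComplex.exact_of_g_is_cokernel _ ?_) hb hj
  refine CokernelCofork.IsColimit.ofπ' _ _ fun {A} k hk => ⟨hS.exact.desc (a ≫ k) ?_, ?_⟩
  · rw [reassoc_of% h.w, hk, comp_zero]
  · apply h.hom_ext
    · simp
    · simpa using hk.symm

/-- If every extension of `A` by `B` splits then `Ext¹(A, B) = 0`. -/
lemma extOneVanishes_of_exists_section [EnoughInjectives C] {A B : C}
    (h : ∀ (M : C) (i : B ⟶ M) (p : M ⟶ A) (hip : i ≫ p = 0),
      (ShortComplex.mk i p hip).ShortExact → ∃ s : A ⟶ M, s ≫ p = 𝟙 A) :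
    ExtOneVanishes A B := by
  let := HasExt.standard C
  -- Dimension shift: each class in `Ext¹(A, B)` is the connecting image of some `f : A ⟶ S.X₃`, and
  -- it vanishes once `f` lifts to `S.X₂`.
  let S := ShortComplex.mk (Injective.ι B) (cokernel.π (Injective.ι B)) (cokernel.condition _)
  have hS : S.ShortExact :=
    { exact := ShortComplex.exact_of_g_is_cokernel _ (cokernelIsCokernel S.f) }
  have := hS.epi_g
  have : Subsingleton (Ext.{max w v} A S.X₂ 1) :=
    Ext.subsingleton_of_injective A (Injective.under B) 0
  refine subsingleton_of_forall_eq (0 : Ext.{max w v} A B 1) fun x => ?_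
  obtain ⟨y, rfl⟩ := Ext.covariant_sequence_exact₁ A hS x (Subsingleton.elim _ _) (zero_add 1)
  obtain ⟨f, rfl⟩ := Ext.addEquiv₀.symm.surjective y
  obtain ⟨j, wj, -, hj⟩ := exists_shortExact_of_isPullback hS (IsPullback.of_hasPullback S.g f)
  obtain ⟨s, hs⟩ := h _ j _ wj hj
  have hf : f = (s ≫ pullback.fst S.g f) ≫ S.g := by
    rw [Category.assoc, pullback.condition, reassoc_of% hs]
  have e : Ext.addEquiv₀.symm f = (Ext.mk₀ (s ≫ pullback.fst S.g f)).comp (Ext.mk₀ S.g)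
      (add_zero 0) := by
    rw [Ext.mk₀_comp_mk₀, ← hf]; rfl
  rw [e, Ext.comp_assoc_of_second_deg_zero, hS.comp_extClass, Ext.comp_zero]

/-- If every extension of `A` by `B` splits then `Ext¹(A, B) = 0`. -/
lemma extOneVanishes_of_exists_retraction [EnoughInjectives C] {A B : C}
    (h : ∀ (M : C) (i : B ⟶ M) (p : M ⟶ A) (hip : i ≫ p = 0),
      (ShortComplex.mk i p hip).ShortExact → ∃ r : M ⟶ B, i ≫ r = 𝟙 B) :
    ExtOneVanishes A B := by
  refine extOneVanishes_of_exists_section fun M i p hip hS => ?_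
  obtain ⟨r, hr⟩ := h M i p hip hS
  let σ := ShortComplex.Splitting.ofExactOfRetraction _ hS.exact r hr hS.epi_g
  exact ⟨σ.s, σ.s_g⟩

/-- If every object is a quotient of an object of `P` by an object of `P^⊥`, then every object
embeds into an object of `P^⊥` with cokernel in `P`. -/
lemma exists_mono_rightOrth [EnoughInjectives C] {P : ObjectProperty C}
    (hP : IsSpecialPrecovering P) (M : C) :
    ∃ (B A : C) (i : M ⟶ B) (p : B ⟶ A) (h : i ≫ p = 0),
      (ShortComplex.mk i p h).ShortExact ∧ P A ∧ rightOrth P B := by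
  let S := ShortComplex.mk (Injective.ι M) (cokernel.π (Injective.ι M)) (cokernel.condition _)
  have hS : S.ShortExact :=
    { exact := ShortComplex.exact_of_g_is_cokernel _ (cokernelIsCokernel S.f)
      epi_g := inferInstanceAs (Epi (cokernel.π (Injective.ι M))) }
  obtain ⟨K, A, i, p, w, hT, hA, hK⟩ := hP S.X₃
  -- The pullback has two kernel sequences: one puts `M` inside it with cokernel `A`, the other
  -- makes it an extension of an injective by `K`, hence an object of `P^⊥`.
  have sq := IsPullback.of_hasPullback S.g p
  obtain ⟨j, wj, -, hj⟩ := exists_shortExact_of_isPullback hS sq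
  obtain ⟨k, wk, -, hk⟩ := exists_shortExact_of_isPullback hT sq.flip
  exact ⟨_, A, j, _, wj, hj, hA, rightOrth_of_shortExact P hk hK
    fun Z _ => extOneVanishes_of_injective Z (Injective.under M)⟩

/-- If every object embeds into an object of `P` with cokernel in `^⊥P`, then every object is a
quotient of an object of `^⊥P` by an object of `P`. -/
lemma exists_epi_leftOrth [EnoughProjectives C] {P : ObjectProperty C}
    (hP : IsSpecialPreenveloping P) (M : C) :
    ∃ (L A : C) (i : L ⟶ A) (p : A ⟶ M) (h : i ≫ p = 0),
      (ShortComplex.mk i p h).ShortExact ∧ leftOrth P A ∧ P L := by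
  let S := ShortComplex.mk (kernel.ι (Projective.π M)) (Projective.π M) (kernel.condition _)
  have hS : S.ShortExact :=
    { exact := ShortComplex.exact_of_f_is_kernel _ (kernelIsKernel S.g)
      mono_f := inferInstanceAs (Mono (kernel.ι (Projective.π M))) }
  obtain ⟨A, L, i, p, w, hT, hA, hL⟩ := hP S.X₁
  have sq := IsPushout.of_hasPushout S.f i
  obtain ⟨j, wj, -, hj⟩ := exists_shortExact_of_isPushout hS sq
  obtain ⟨k, wk, -, hk⟩ := exists_shortExact_of_isPushout hT sq.flip
  exact ⟨A, _, _, j, wj, hj, leftOrth_of_shortExact P hk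
    (fun Z _ => extOneVanishes_of_projective (Projective.over M) Z) hL, hA⟩

/-- The kernel of `(r, q) : B ⊞ A ⟶ Y` is an extension of `B` by the kernel of the
epimorphism `q`. -/
lemma exists_shortExact_kernel_biprod_desc {S : ShortComplex C} (hS : S.ShortExact) {B K : C}
    {k : K ⟶ B ⊞ S.X₂} {φ : B ⊞ S.X₂ ⟶ S.X₃} (hφ : biprod.inr ≫ φ = S.g) (wk : k ≫ φ = 0)
    (hk : IsLimit (KernelFork.ofι k wk)) :
    ∃ (j : S.X₁ ⟶ K) (b : K ⟶ B) (wj : j ≫ b = 0), (ShortComplex.mk j b wj).ShortExact := by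
  have hk0 : k ≫ biprod.fst ≫ biprod.inl ≫ φ + k ≫ biprod.snd ≫ S.g = 0 := by
    rw [← hφ, ← wk, ← Preadditive.comp_add]
    congr 1
    ext <;> simp
  have hc (s : PullbackCone S.g (-(biprod.inl ≫ φ))) : biprod.lift s.snd s.fst ≫ φ = 0 := by
    have hφ' : φ = biprod.desc (biprod.inl ≫ φ) S.g := by ext <;> simp [hφ]
    refine (congrArg (biprod.lift s.snd s.fst ≫ ·) hφ').trans ?_
    rw [biprod.lift_desc, s.condition]
    simp
  -- The sign turns "the two components sum to zero" into a commutative square.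
  have sq : IsPullback (k ≫ biprod.snd) (k ≫ biprod.fst) S.g (-(biprod.inl ≫ φ)) := by
    refine ⟨⟨?_⟩, ⟨PullbackCone.IsLimit.mk _ (fun s => hk.lift (KernelFork.ofι
      (biprod.lift s.snd s.fst) (hc s))) (fun s => ?_) (fun s => ?_) (fun s m h₁ h₂ => ?_)⟩⟩
    · rw [add_comm] at hk0
      simpa using eq_neg_of_add_eq_zero_left hk0
    · have := hk.fac (KernelFork.ofι (biprod.lift s.snd s.fst) (hc s)) WalkingParallelPair.zero
      dsimp at this
      rw [reassoc_of% this, biprod.lift_snd]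
    · have := hk.fac (KernelFork.ofι (biprod.lift s.snd s.fst) (hc s)) WalkingParallelPair.zero
      dsimp at this
      rw [reassoc_of% this, biprod.lift_fst]
    · refine Fork.IsLimit.hom_ext hk ?_
      have := hk.fac (KernelFork.ofι (biprod.lift s.snd s.fst) (hc s)) WalkingParallelPair.zero
      dsimp at this ⊢
      rw [this]
      ext <;> simp [h₁, h₂]
  obtain ⟨j, wj, -, hj⟩ := exists_shortExact_of_isPullback hS sq
  exact ⟨j, _, wj, hj⟩

/-- The cokernel of `(i, s) : Y ⟶ B ⊞ A` is an extension of the cokernel of the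
monomorphism `i` by `A`. -/
lemma exists_shortExact_cokernel_biprod_lift {S : ShortComplex C} (hS : S.ShortExact) {A Q : C}
    {ψ : S.X₁ ⟶ S.X₂ ⊞ A} {c : S.X₂ ⊞ A ⟶ Q} (hψ : ψ ≫ biprod.fst = S.f) (wc : ψ ≫ c = 0)
    (hc : IsColimit (CokernelCofork.ofπ c wc)) :
    ∃ (b : A ⟶ Q) (q : Q ⟶ S.X₃) (wq : b ≫ q = 0), (ShortComplex.mk b q wq).ShortExact := by
  have hψ' : ψ = biprod.lift S.f (ψ ≫ biprod.snd) := by ext <;> simp [hψ]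
  have hc0 : S.f ≫ biprod.inl ≫ c + (ψ ≫ biprod.snd) ≫ biprod.inr ≫ c = 0 := by
    rw [← biprod.lift_desc, ← hψ', ← wc]
    congr 1
    ext <;> simp
  have hk (s : PushoutCocone S.f (-(ψ ≫ biprod.snd))) : ψ ≫ biprod.desc s.inl s.inr = 0 := by
    refine (congrArg (· ≫ biprod.desc s.inl s.inr) hψ').trans ?_
    rw [biprod.lift_desc, s.condition]
    simp
  have sq : IsPushout S.f (-(ψ ≫ biprod.snd)) (biprod.inl ≫ c) (biprod.inr ≫ c) := by
    refine ⟨⟨?_⟩, ⟨PushoutCocone.IsColimit.mk _ (fun s => hc.desc (CokernelCofork.ofπ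
      (biprod.desc s.inl s.inr) (hk s))) (fun s => ?_) (fun s => ?_) (fun s m h₁ h₂ => ?_)⟩⟩
    · simpa using eq_neg_of_add_eq_zero_left hc0
    · have := hc.fac (CokernelCofork.ofπ (biprod.desc s.inl s.inr) (hk s)) WalkingParallelPair.one
      dsimp at this
      rw [Category.assoc, this, biprod.inl_desc]
    · have := hc.fac (CokernelCofork.ofπ (biprod.desc s.inl s.inr) (hk s)) WalkingParallelPair.one
      dsimp at this
      rw [Category.assoc, this, biprod.inr_desc]
    · refine Cofork.IsColimit.hom_ext hc ?_
      have := hc.fac (CokernelCofork.ofπ (biprod.desc s.inl s.inr) (hk s)) WalkingParallelPair.one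
      dsimp at this ⊢
      rw [this]
      simp only [Category.assoc] at h₁ h₂
      ext <;> simp [h₁, h₂]
  obtain ⟨q, wq, -, hq⟩ := exists_shortExact_of_isPushout hS sq
  exact ⟨_, q, wq, hq⟩

end Abelian

/-! ### A kernel of a map of injectives as a directed intersection of injectives -/

section DirectedIntersection

open Cardinal

variable {R : Type u} [Ring R] {M N : Type u} [AddCommGroup M] [AddCommGroup N]
  [Module R M] [Module R N] (f : M →ₗ[R] N) (I : Type u)

/-- The pairs `(m, x)` in `M × Nᴵ` such that `x i = f m` for all `i` in `S` and the support of `x`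
has cardinality at most `max ℵ₀ #R`. -/
def agreeingSubmodule (S : Finset I) : Submodule R (M × (I → N)) where
  carrier := {z | (∀ i ∈ S, z.2 i = f z.1) ∧ #{i | z.2 i ≠ 0} ≤ max ℵ₀ #R}
  zero_mem' := by simp
  add_mem' {a b} ha hb := by
    refine ⟨fun i hi => by simp [ha.1 i hi, hb.1 i hi], ?_⟩
    refine (mk_le_mk_of_subset (t := {i | a.2 i ≠ 0} ∪ {i | b.2 i ≠ 0}) fun i hi => ?_).trans
      ((mk_union_le _ _).trans (add_le_of_le (le_max_left _ _) ha.2 hb.2))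
    by_contra h
    simp only [Set.mem_union, Set.mem_ofPred_eq, not_or, not_not] at h
    exact hi (by simp [h.1, h.2])
  smul_mem' r a ha := by
    refine ⟨fun i hi => by simp [ha.1 i hi], (mk_le_mk_of_subset fun i hi => ?_).trans ha.2⟩
    exact fun h => hi (by simp [h])

variable {f I}

lemma agreeingSubmodule_antitone : Antitone (agreeingSubmodule (R := R) f I) :=
  fun _ _ h _ hz => ⟨fun i hi => hz.1 i (h hi), hz.2⟩

/-- Baer's criterion: an ideal has at most `#R` elements, so the supports of all values of `g`
together still satisfy the cardinality bound, and the extension can be chosen to vanish off them and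
off the finite set `S`. -/
lemma injective_agreeingSubmodule [Module.Injective R M] [Module.Injective R N] (S : Finset I) :
    Module.Injective R (agreeingSubmodule (R := R) f I S) := by
  classical
  refine Module.Baer.injective fun J g => ?_
  let W := agreeingSubmodule (R := R) f I S
  obtain ⟨a, ha⟩ := Module.Baer.of_injective (R := R) (Q := M) inferInstance J
    (LinearMap.fst R M (I → N) ∘ₗ W.subtype ∘ₗ g)
  -- Coordinates where `g` vanishes identically are extended by zero, which keeps the support small.
  have hN (i : I) : ∃ b : R →ₗ[R] N, (∀ x (hx : x ∈ J), b x = (g ⟨x, hx⟩).1.2 i) ∧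
      ((∀ x, (g x).1.2 i = 0) → b = 0) := by
    by_cases h : ∀ x, (g x).1.2 i = 0
    · exact ⟨0, fun x hx => by simp [h], fun _ => rfl⟩
    · obtain ⟨b, hb⟩ := Module.Baer.of_injective (R := R) (Q := N) inferInstance J
        (LinearMap.proj i ∘ₗ LinearMap.snd R M (I → N) ∘ₗ W.subtype ∘ₗ g)
      exact ⟨b, hb, fun h' => absurd h' h⟩
  choose b hb hb0 using hN
  let F : R →ₗ[R] M × (I → N) :=
    -- Coordinates in `S` are dictated by the first component.
    a.prod (LinearMap.pi fun i => if i ∈ S then f ∘ₗ a else b i)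
  have hF (r : R) : F r ∈ W := by
    refine ⟨fun i hi => by simp [F, hi], ?_⟩
    have hsub : {i | (F r).2 i ≠ 0} ⊆ (S : Set I) ∪ ⋃ x : J, {i | (g x).1.2 i ≠ 0} := by
      intro i hi
      by_cases hS : i ∈ S
      · exact Or.inl hS
      · refine Or.inr (Set.mem_iUnion.2 ?_)
        by_contra! h
        exact hi (by simp [F, hS, hb0 i fun x => not_not.1 (h x)])
    refine (mk_le_mk_of_subset hsub).trans ((mk_union_le _ _).trans
      (add_le_of_le (le_max_left _ _) ?_ ?_))
    · exact (S.finite_toSet.lt_aleph0.le).trans (le_max_left _ _)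
    · refine (mk_iUnion_le _).trans (mul_le_of_le (le_max_left _ _) ?_ ?_)
      · exact (mk_set_le (J : Set R)).trans (le_max_right _ _)
      · exact ciSup_le' fun x => (g x).2.2
  refine ⟨F.codRestrict W hF, fun x hx => Subtype.ext (Prod.ext (ha x hx) (funext fun i => ?_))⟩
  by_cases hS : i ∈ S
  · have := (g ⟨x, hx⟩).2.1 i hS
    simp only [LinearMap.codRestrict_apply, F, LinearMap.prod_apply, Function.prod_apply,
      LinearMap.pi_apply, hS, if_true, LinearMap.comp_apply, this]
    exact congrArg f (ha x hx)
  · simpa [F, hS] using hb i x hx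

/-- Singletons `S` force every coordinate to equal `f z.1`; were this nonzero, the support would be
all of `I`, which is too large. -/
lemma mem_iInf_agreeingSubmodule (hI : max ℵ₀ #R < #I) (z : M × (I → N)) :
    (∀ S, z ∈ agreeingSubmodule (R := R) f I S) ↔ f z.1 = 0 ∧ z.2 = 0 := by
  constructor
  · intro h
    have hz (i : I) : z.2 i = f z.1 := (h {i}).1 i (by simp)
    have h0 : f z.1 = 0 := by
      by_contra h0
      have := (h ∅).2
      rw [show {i | z.2 i ≠ 0} = Set.univ from Set.eq_univ_of_forall fun i => by simp [hz, h0],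
        mk_univ] at this
      exact absurd hI this.not_gt
    exact ⟨h0, funext fun i => (hz i).trans h0⟩
  · rintro ⟨h1, h2⟩ S
    exact ⟨fun i _ => by simp [h1, h2], by simp [h2]⟩

end DirectedIntersection

/-! ### Inverse limits of injective modules -/

section InverseLimit

variable {R : Type u} [Ring R]

/-- The inverse system of submodules defined by an antitone family. -/
@[simps]
def submoduleSystem {J : Type u} [Preorder J] {W : Type u} [AddCommGroup W] [Module R W]
    (E : J → Submodule R W) (hE : Antitone E) : Jᵒᵖ ⥤ ModuleCat.{u} R where
  obj j := ModuleCat.of R (E j.unop)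
  map φ := ModuleCat.ofHom (Submodule.inclusion (hE φ.unop.le))

/-- The cone over a system of submodules given by a map into their intersection. -/
@[simps]
def submoduleSystemCone {J : Type u} [Preorder J] {W : Type u} [AddCommGroup W] [Module R W]
    (E : J → Submodule R W) (hE : Antitone E) (M : ModuleCat.{u} R) (g : M →ₗ[R] W)
    (hg : ∀ j m, g m ∈ E j) : Cone (submoduleSystem E hE) where
  pt := M
  π := { app := fun j => ModuleCat.ofHom (g.codRestrict (E j.unop) (hg j.unop)) }

/-- The intersection of a directed system of submodules is its inverse limit. -/
def isLimitSubmoduleSystemCone {J : Type u} [Preorder J] [IsDirected J (· ≤ ·)] [Nonempty J]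
    {W : Type u} [AddCommGroup W] [Module R W]
    (E : J → Submodule R W) (hE : Antitone E) (M : ModuleCat.{u} R) (g : M →ₗ[R] W)
    (hg : ∀ j m, g m ∈ E j) (hinj : Function.Injective g)
    (hsurj : ∀ z, (∀ j, z ∈ E j) → z ∈ LinearMap.range g) :
    IsLimit (submoduleSystemCone E hE M g hg) := by
  -- By directedness all legs of a cone agree as maps into `W`.
  have val (s : Cone (submoduleSystem E hE)) (j k : J) (x : s.pt) :
      ((s.π.app (.op j)).hom x : E j).1 = ((s.π.app (.op k)).hom x : E k).1 := by
    obtain ⟨l, hjl, hkl⟩ := exists_ge_ge j k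
    have e (i : J) (h : i ≤ l) :
        ((s.π.app (.op l)).hom x : E l).1 = ((s.π.app (.op i)).hom x : E i).1 := by
      rw [← s.w (homOfLE h).op]; rfl
    rw [← e j hjl, ← e k hkl]
  let j₀ : J := Classical.arbitrary J
  let toW (s : Cone (submoduleSystem E hE)) : s.pt →ₗ[R] W :=
    (E j₀).subtype ∘ₗ (s.π.app (.op j₀)).hom
  have mem (s : Cone (submoduleSystem E hE)) (x : s.pt) : toW s x ∈ LinearMap.range g :=
    hsurj _ fun j => by
      have := ((s.π.app (.op j)).hom x : E j).2
      rwa [val s j j₀ x] at this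
  let l (s : Cone (submoduleSystem E hE)) : s.pt →ₗ[R] M :=
    (LinearEquiv.ofInjective g hinj).symm.toLinearMap ∘ₗ (toW s).codRestrict _ (mem s)
  have hl (s : Cone (submoduleSystem E hE)) (x : s.pt) : g (l s x) = toW s x :=
    congrArg Subtype.val ((LinearEquiv.ofInjective g hinj).apply_symm_apply
      ((toW s).codRestrict _ (mem s) x))
  refine { lift := fun s => ModuleCat.ofHom (l s), fac := fun s j => ?_, uniq := fun s m h => ?_ }
  · ext x
    exact Subtype.ext ((hl s x).trans (val s j₀ j.unop x))
  · ext x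
    apply hinj
    refine Eq.trans ?_ (hl s x).symm
    have := h (.op j₀)
    exact congrArg (fun φ => ((ModuleCat.Hom.hom φ) x : E j₀).1) this

/-- A class of modules which contains the injective modules and is closed under inverse limits
contains every module. -/
theorem prop_of_isClosedUnderInverseLimits (P : ObjectProperty (ModuleCat.{u} R))
    (hP : IsClosedUnderInverseLimits P) (hinj : ∀ E : ModuleCat.{u} R, Injective E → P E)
    (M : ModuleCat.{u} R) : P M := by
  let M₀ : ModuleCat.{u} R := Injective.under M
  let N₀ : ModuleCat.{u} R := Injective.under (cokernel (Injective.ι M))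
  let f : M₀ ⟶ N₀ :=
    cokernel.π (Injective.ι M) ≫ Injective.ι _
  have hf : (ShortComplex.mk (Injective.ι M) f (by simp [f])).Exact := by
    have h : (ShortComplex.mk (Injective.ι M) (cokernel.π (Injective.ι M)) (by simp)).Exact :=
      ShortComplex.exact_of_g_is_cokernel _ (cokernelIsCokernel _)
    rw [ShortComplex.exact_iff_kernel_ι_comp_cokernel_π_zero] at h ⊢
    have : kernel.ι f ≫ cokernel.π (Injective.ι M) = 0 := by
      rw [← cancel_mono (Injective.ι (cokernel (Injective.ι M))), Category.assoc,
        kernel.condition, zero_comp]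
    simpa using this
  rw [ShortComplex.moduleCat_exact_iff] at hf
  have : Module.Injective R M₀ := (Module.injective_iff_injective_object R M₀).2
    (inferInstanceAs (Injective (Injective.under M)))
  have : Module.Injective R N₀ := (Module.injective_iff_injective_object R N₀).2
    (inferInstanceAs (Injective (Injective.under _)))
  let μ := max Cardinal.aleph0.{u} (Cardinal.mk R)
  let I : Type u := ((2 : Cardinal.{u}) ^ μ).out
  have hI : μ < Cardinal.mk I := by
    rw [Cardinal.mk_out]; exact Cardinal.cantor μ
  have hι : Function.Injective (Injective.ι M).hom :=
    (ModuleCat.mono_iff_injective _).1 inferInstance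
  let g : M →ₗ[R] M₀ × (I → N₀) :=
    LinearMap.inl R _ _ ∘ₗ (Injective.ι M).hom
  have h0 (m : M) : f.hom ((Injective.ι M).hom m) = 0 := by
    have : Injective.ι M ≫ f = 0 := by simp [f]
    exact congrArg (fun φ => (ModuleCat.Hom.hom φ) m) this
  have hl := isLimitSubmoduleSystemCone (agreeingSubmodule f.hom I) agreeingSubmodule_antitone M g
    (fun S m => (mem_iInf_agreeingSubmodule hI _).2 ⟨h0 m, rfl⟩ S)
    (fun x y hxy => hι (congrArg Prod.fst hxy)) (fun z hz => by
      obtain ⟨h1, h2⟩ := (mem_iInf_agreeingSubmodule hI z).1 hz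
      obtain ⟨m, hm⟩ := hf _ h1
      exact ⟨m, Prod.ext hm h2.symm⟩)
  have := hP (Finset I)
  refine P.prop_of_isLimit hl fun S => hinj _ ?_
  exact (Module.injective_iff_injective_object R _).1 (injective_agreeingSubmodule S.unop)

end InverseLimit

/-- Isolates the transport along `n - 1 + 1 = n` needed to define a family on `ℤ` by its values at
successors. -/
lemma exists_family_of_succ {T : ℤ → Sort*} (t : ∀ n, T (n + 1)) :
    ∃ h : ∀ n, T n, ∀ n, h (n + 1) = t n := by
  refine ⟨fun n => cast (congrArg T (sub_add_cancel n 1)) (t (n - 1)), fun n => ?_⟩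
  refine eq_of_heq ((cast_heq _ _).trans ?_)
  rw [add_sub_cancel_right]

/-! ### Contractible complexes and their universal properties -/

section Contractible

variable {C : Type w} [Category.{v} C] [Abelian C] (B A : ℤ → C) (e : ∀ n, A n ≅ B (n + 1))

/-- The contractible complex with terms `B n ⊞ A n`, whose differential is the isomorphism
`A n ≅ B (n + 1)`. -/
def contractible : CochainComplex C ℤ :=
  CochainComplex.of (fun n => B n ⊞ A n) (fun n => biprod.snd ≫ (e n).hom ≫ biprod.inl) (by simp)

namespace contractible

/-- The inclusion of the cycles. -/
def inl (n : ℤ) : B n ⟶ (contractible B A e).X n := biprod.inl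

/-- The inclusion of the complement of the cycles. -/
def inr (n : ℤ) : A n ⟶ (contractible B A e).X n := biprod.inr

/-- The projection to the cycles. -/
def fst (n : ℤ) : (contractible B A e).X n ⟶ B n := biprod.fst

/-- The projection to the complement of the cycles. -/
def snd (n : ℤ) : (contractible B A e).X n ⟶ A n := biprod.snd

@[simp]
lemma inl_fst (n : ℤ) : inl B A e n ≫ fst B A e n = 𝟙 _ := biprod.inl_fst

@[simp]
lemma inl_snd (n : ℤ) : inl B A e n ≫ snd B A e n = 0 := biprod.inl_snd

@[simp]
lemma inr_fst (n : ℤ) : inr B A e n ≫ fst B A e n = 0 := biprod.inr_fst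

@[simp]
lemma inr_snd (n : ℤ) : inr B A e n ≫ snd B A e n = 𝟙 _ := biprod.inr_snd

@[simp]
lemma inl_fst_assoc (n : ℤ) {Z : C} (f : B n ⟶ Z) : inl B A e n ≫ fst B A e n ≫ f = f :=
  biprod.inl_fst_assoc f

@[simp]
lemma inl_snd_assoc (n : ℤ) {Z : C} (f : A n ⟶ Z) : inl B A e n ≫ snd B A e n ≫ f = 0 :=
  (biprod.inl_snd_assoc f).trans zero_comp

@[simp]
lemma inr_fst_assoc (n : ℤ) {Z : C} (f : B n ⟶ Z) : inr B A e n ≫ fst B A e n ≫ f = 0 :=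
  (biprod.inr_fst_assoc f).trans zero_comp

@[simp]
lemma inr_snd_assoc (n : ℤ) {Z : C} (f : A n ⟶ Z) : inr B A e n ≫ snd B A e n ≫ f = f :=
  biprod.inr_snd_assoc f

instance (n : ℤ) : Mono (inl B A e n) := inferInstanceAs (Mono (biprod.inl : B n ⟶ B n ⊞ A n))

variable {B A e}

lemma to_ext {Z : C} {n : ℤ} {f g : Z ⟶ (contractible B A e).X n}
    (h₁ : f ≫ fst B A e n = g ≫ fst B A e n) (h₂ : f ≫ snd B A e n = g ≫ snd B A e n) : f = g :=
  biprod.hom_ext _ _ h₁ h₂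

lemma from_ext {Z : C} {n : ℤ} {f g : (contractible B A e).X n ⟶ Z}
    (h₁ : inl B A e n ≫ f = inl B A e n ≫ g) (h₂ : inr B A e n ≫ f = inr B A e n ≫ g) : f = g :=
  biprod.hom_ext' _ _ h₁ h₂

lemma d_eq (n : ℤ) : (contractible B A e).d n (n + 1) =
    snd B A e n ≫ (e n).hom ≫ inl B A e (n + 1) :=
  CochainComplex.of_d (fun n => B n ⊞ A n) (fun n => biprod.snd ≫ (e n).hom ≫ biprod.inl) n

lemma eq_of_comp_d_eq_zero {T : C} {n : ℤ} (x : T ⟶ (contractible B A e).X n)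
    (hx : x ≫ (contractible B A e).d n (n + 1) = 0) : (x ≫ fst B A e n) ≫ inl B A e n = x := by
  rw [d_eq, ← Category.assoc, ← Category.assoc] at hx
  have : x ≫ snd B A e n = 0 :=
    (cancel_mono (e n).hom).1 ((zero_of_comp_mono (inl B A e _) hx).trans zero_comp.symm)
  exact to_ext (by simp) (by simpa using this.symm)

/-- Commutation with the differentials determines the `snd` component in degree `n` from the `fst`
component in degree `n + 1`. -/
lemma hom_to_ext {M : CochainComplex C ℤ} {φ ψ : M ⟶ contractible B A e}
    (h : ∀ n, φ.f n ≫ fst B A e n = ψ.f n ≫ fst B A e n) : φ = ψ := by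
  have key (χ : M ⟶ contractible B A e) (n : ℤ) : χ.f n ≫ snd B A e n =
      M.d n (n + 1) ≫ (χ.f (n + 1) ≫ fst B A e (n + 1)) ≫ (e n).inv := by
    rw [Category.assoc, ← χ.comm_assoc, d_eq]
    simp
  ext n
  exact to_ext (h n) (by rw [key, key, h])

lemma hom_from_ext {M : CochainComplex C ℤ} {φ ψ : contractible B A e ⟶ M}
    (h : ∀ n, inr B A e n ≫ φ.f n = inr B A e n ≫ ψ.f n) : φ = ψ := by
  have key (χ : contractible B A e ⟶ M) (n : ℤ) : inl B A e (n + 1) ≫ χ.f (n + 1) =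
      (e n).inv ≫ (inr B A e n ≫ χ.f n) ≫ M.d n (n + 1) := by
    rw [Category.assoc, χ.comm, d_eq]
    simp
  ext n
  refine from_ext ?_ (h n)
  obtain ⟨m, rfl⟩ : ∃ m, n = m + 1 := ⟨n - 1, by omega⟩
  rw [key, key, h]

variable (B A e) in
lemma exists_lift {M : CochainComplex C ℤ} (f : ∀ n, M.X n ⟶ B n) :
    ∃ φ : M ⟶ contractible B A e, ∀ n, φ.f n ≫ fst B A e n = f n := by
  refine ⟨{ f := fun n => f n ≫ inl B A e n +
              M.d n (n + 1) ≫ f (n + 1) ≫ (e n).inv ≫ inr B A e n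
            comm' := fun i j hij => ?_ }, fun n => by simp⟩
  obtain rfl : i + 1 = j := hij
  simp [d_eq]

variable (B A e) in
lemma exists_desc {M : CochainComplex C ℤ} (g : ∀ n, A n ⟶ M.X n) :
    ∃ φ : contractible B A e ⟶ M, ∀ n, inr B A e n ≫ φ.f n = g n := by
  obtain ⟨h, hh⟩ := exists_family_of_succ (T := fun n => B n ⟶ M.X n)
    -- The only value on `B (n + 1)` compatible with the differentials.
    fun n => (e n).inv ≫ g n ≫ M.d n (n + 1)
  have hd (n : ℤ) : h n ≫ M.d n (n + 1) = 0 := by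
    obtain ⟨m, rfl⟩ : ∃ m, n = m + 1 := ⟨n - 1, by omega⟩
    simp [hh]
  refine ⟨{ f := fun n => fst B A e n ≫ h n + snd B A e n ≫ g n
            comm' := fun i j hij => ?_ }, fun n => by simp⟩
  obtain rfl : i + 1 = j := hij
  simp [d_eq, hd, hh]

variable (B A e)

lemma acyclic : (contractible B A e).Acyclic := by
  intro n
  obtain ⟨m, rfl⟩ : ∃ m, n = m + 1 := ⟨n - 1, by omega⟩
  rw [HomologicalComplex.exactAt_iff' _ m (m + 1) (m + 1 + 1) (by simp) (by simp),
    ShortComplex.exact_iff_exact_up_to_refinements]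
  intro T (x : T ⟶ (contractible B A e).X (m + 1)) hx
  refine ⟨T, 𝟙 _, inferInstance, x ≫ fst B A e (m + 1) ≫ (e m).inv ≫ inr B A e m, ?_⟩
  have hd : inr B A e m ≫ (contractible B A e).d m (m + 1) = (e m).hom ≫ inl B A e (m + 1) := by
    simp [d_eq]
  have hxd : (x ≫ fst B A e (m + 1) ≫ (e m).inv ≫ inr B A e m) ≫
      (contractible B A e).d m (m + 1) = (x ≫ fst B A e (m + 1)) ≫ inl B A e (m + 1) := by
    simp only [Category.assoc, hd, Iso.inv_hom_id_assoc]
  exact (Category.id_comp x).trans ((hxd.trans (eq_of_comp_d_eq_zero x hx)).symm)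

/-- The cycles of the contractible complex. -/
def cyclesIso (n : ℤ) : B n ≅ (contractible B A e).cycles n :=
  IsLimit.conePointUniqueUpToIso
    (KernelFork.IsLimit.ofι' (inl B A e n) (show inl B A e n ≫ (contractible B A e).d n (n + 1) = 0
      by simp [d_eq]) fun {T} x hx => ⟨x ≫ fst B A e n, eq_of_comp_d_eq_zero x hx⟩)
    ((contractible B A e).cyclesIsKernel n (n + 1) (by simp))

end contractible

end Contractible

/-! ### Preenvelopes and precovers of complexes -/

section Modules

variable {R : Type u} [Ring R] {X : ObjectProperty (ModuleCat.{u} R)}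

/-- A retraction of an extension by this complex needs only degreewise extensions of `fst`, which
exist because each `B n` is `X`-injective. -/
lemma cInjective_contractible (B A : ℤ → ModuleCat.{u} R) (e : ∀ n, A n ≅ B (n + 1))
    (hB : ∀ n, XInjective X (B n)) : CInjective X (contractible B A e) := by
  refine fun Z hZ => extOneVanishes_of_exists_retraction fun M i p hip hS => ?_
  rw [HomologicalComplex.shortExact_iff_degreewise_shortExact] at hS
  choose f hf using fun n =>
    ExtOneVanishes.exists_extension (hS n) (hB n _ (hZ n)) (contractible.fst B A e n)
  obtain ⟨r, hr⟩ := contractible.exists_lift B A e f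
  refine ⟨r, contractible.hom_to_ext fun n => ?_⟩
  rw [HomologicalComplex.comp_f, Category.assoc, hr, HomologicalComplex.id_f, Category.id_comp]
  exact hf n

lemma cProjective_contractible (B A : ℤ → ModuleCat.{u} R) (e : ∀ n, A n ≅ B (n + 1))
    (hA : ∀ n, XProjective X (A n)) : CProjective X (contractible B A e) := by
  refine fun Z hZ => extOneVanishes_of_exists_section fun M i p hip hS => ?_
  rw [HomologicalComplex.shortExact_iff_degreewise_shortExact] at hS
  choose f hf using fun n =>
    ExtOneVanishes.exists_lift (hS n) (hA n _ (hZ n)) (contractible.inr B A e n)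
  obtain ⟨s, hs⟩ := contractible.exists_desc B A e f
  refine ⟨s, contractible.hom_from_ext fun n => ?_⟩
  rw [HomologicalComplex.comp_f, ← Category.assoc, hs, HomologicalComplex.id_f, Category.comp_id]
  exact hf n

/-- If every module embeds into an `X`-injective module with cokernel in `X`, then every complex
embeds into a contractible complex of `X`-injective modules which is a
`C(X-injective)`-preenvelope. -/
theorem exists_mono_preenvelope (hinj : XInjective X ≤ X) [X.IsClosedUnderExtensions]
    (hX : ∀ M : ModuleCat.{u} R, ∃ (B A : ModuleCat.{u} R) (i : M ⟶ B) (p : B ⟶ A)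
      (h : i ≫ p = 0), (ShortComplex.mk i p h).ShortExact ∧ X A ∧ XInjective X B)
    (Y : CochainComplex (ModuleCat.{u} R) ℤ) :
    ∃ (E : CochainComplex (ModuleCat.{u} R) ℤ) (φ : Y ⟶ E),
      IsPreenvelope (CInjective X) φ ∧ Mono φ ∧ E.Acyclic ∧ EpsilonClass (XInjective X) E := by
  choose B Q i p h hS hQ hB using fun n => hX (Y.X n)
  let E := contractible B (fun n => B (n + 1)) fun n => Iso.refl _
  obtain ⟨φ, hφ⟩ := contractible.exists_lift B (fun n => B (n + 1)) (fun n => Iso.refl _) i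
  have (n : ℤ) : Mono (φ.f n) := by
    have : Mono (φ.f n ≫ contractible.fst B _ _ n) := by rw [hφ]; exact (hS n).mono_f
    exact mono_of_mono _ (contractible.fst B _ _ n)
  have hmono : Mono φ := HomologicalComplex.mono_of_mono_f φ this
  have hse : (ShortComplex.mk φ (cokernel.π φ) (cokernel.condition φ)).ShortExact :=
    { exact := ShortComplex.exact_of_g_is_cokernel _ (cokernelIsCokernel φ) }
  have hse' := (HomologicalComplex.shortExact_iff_degreewise_shortExact _).1 hse
  have hZ : CStar X (cokernel φ) := fun n => by
    obtain ⟨b, q, w, hbq⟩ := exists_shortExact_cokernel_biprod_lift (hS n) (A := B (n + 1))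
      (ψ := φ.f n) (hφ n) _ (hse' n).gIsCokernel
    exact X.prop_X₂_of_shortExact hbq (hinj _ (hB _)) (hQ n)
  have hac : E.Acyclic := contractible.acyclic _ _ _
  exact ⟨E, φ, ⟨cInjective_contractible _ _ _ hB, fun F hF f =>
    ExtOneVanishes.exists_extension hse (hF _ hZ) f⟩, hmono, hac, hac, fun n =>
      rightOrth_of_iso X (contractible.cyclesIso _ _ _ n) (hB n)⟩

/-- If every module is a quotient of an `X`-projective module by a submodule in `X`, then every
complex is a quotient of a contractible complex of `X`-projective modules which is a
`C(X-projective)`-precover. -/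
theorem exists_epi_precover (hproj : XProjective X ≤ X) [X.IsClosedUnderExtensions]
    (hX : ∀ M : ModuleCat.{u} R, ∃ (L A : ModuleCat.{u} R) (i : L ⟶ A) (p : A ⟶ M)
      (h : i ≫ p = 0), (ShortComplex.mk i p h).ShortExact ∧ XProjective X A ∧ X L)
    (Y : CochainComplex (ModuleCat.{u} R) ℤ) :
    ∃ (P : CochainComplex (ModuleCat.{u} R) ℤ) (φ : P ⟶ Y),
      IsPrecover (CProjective X) φ ∧ Epi φ ∧ P.Acyclic ∧ EpsilonClass (XProjective X) P := by
  choose L A i p h hS hA hL using fun n => hX (Y.X n)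
  -- The shift places the `X`-projective `A n` as the non-cycle summand in degree `n`, where it maps
  -- onto `Y.X n`.
  let B (n : ℤ) : ModuleCat.{u} R := A (n - 1)
  let e (n : ℤ) : A n ≅ B (n + 1) := eqToIso (congrArg A (add_sub_cancel_right n 1).symm)
  let P := contractible B A e
  obtain ⟨φ, hφ⟩ := contractible.exists_desc B A e p
  have (n : ℤ) : Epi (φ.f n) := by
    have : Epi (contractible.inr B A e n ≫ φ.f n) := by rw [hφ]; exact (hS n).epi_g
    exact epi_of_epi (contractible.inr B A e n) _
  have hepi : Epi φ := HomologicalComplex.epi_of_epi_f φ this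
  have hse : (ShortComplex.mk (kernel.ι φ) φ (kernel.condition φ)).ShortExact :=
    { exact := ShortComplex.exact_of_f_is_kernel _ (kernelIsKernel φ) }
  have hse' := (HomologicalComplex.shortExact_iff_degreewise_shortExact _).1 hse
  have hZ : CStar X (kernel φ) := fun n => by
    obtain ⟨b, q, w, hbq⟩ := exists_shortExact_kernel_biprod_desc (hS n) (B := B n)
      (φ := φ.f n) (hφ n) _ (hse' n).fIsKernel
    exact X.prop_X₂_of_shortExact hbq (hL n) (hproj _ (hA _))
  have hac : P.Acyclic := contractible.acyclic _ _ _
  exact ⟨P, φ, ⟨cProjective_contractible _ _ _ hA, fun F hF f =>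
    ExtOneVanishes.exists_lift hse (hF _ hZ) f⟩, hepi, hac, hac, fun n =>
      leftOrth_of_iso X (contractible.cyclesIso _ _ _ n) (hA _)⟩

/-- Modules are viewed as complexes concentrated in degree `0`; this functor preserves limits, and
zero modules in `X` account for the other degrees. -/
lemma isClosedUnderInverseLimits_of_cStar [X.IsClosedUnderIsomorphisms]
    (h0 : ∀ M : ModuleCat.{u} R, IsZero M → X M)
    (hX : IsClosedUnderInverseLimits (CStar X)) : IsClosedUnderInverseLimits X := by
  intro J _ _ _
  have := hX J
  let G := HomologicalComplex.single (ModuleCat.{u} R) (ComplexShape.up ℤ) 0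
  have hG (M : ModuleCat.{u} R) (hM : X M) : CStar X (G.obj M) := fun n => by
    by_cases hn : n = 0
    · subst hn
      exact X.prop_of_iso (HomologicalComplex.singleObjXSelf (ComplexShape.up ℤ) 0 M).symm hM
    · exact h0 _ (HomologicalComplex.isZero_single_obj_X _ _ _ _ hn)
  refine ⟨?_⟩
  rintro M ⟨⟨F, π, hl⟩, hF⟩
  have hGM : CStar X (G.obj M) :=
    (CStar X).prop_of_isLimit (isLimitOfPreserves G hl) fun j => hG _ (hF j)
  exact X.prop_of_iso (HomologicalComplex.singleObjXSelf (ComplexShape.up ℤ) 0 M) (hGM 0)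

end Modules

end XComplex

open XComplex in
theorem corollary3p8 {R : Type u} [Ring R] (X : ObjectProperty (ModuleCat.{u} R))
    (hinj : XComplex.XInjective X ≤ X) (hproj : XComplex.XProjective X ≤ X) :
    (XComplex.IsClosedUnderDirectSums X → X.IsClosedUnderExtensions →
      XComplex.IsSpecialPrecovering X → XComplex.IsSpecialPreenveloping X →
        (∀ Y : CochainComplex (ModuleCat.{u} R) ℤ, XComplex.IsLeftBounded Y →
          ∃ (E : CochainComplex (ModuleCat.{u} R) ℤ) (φ : Y ⟶ E),
            XComplex.IsPreenvelope (XComplex.CInjective X) φ ∧ Mono φ ∧ E.Acyclic) ∧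
        (∀ Y : CochainComplex (ModuleCat.{u} R) ℤ, XComplex.IsRightBounded Y →
          ∃ (P : CochainComplex (ModuleCat.{u} R) ℤ) (φ : P ⟶ Y),
            XComplex.IsPrecover (XComplex.CProjective X) φ ∧ Epi φ ∧ P.Acyclic)) ∧
    (XComplex.IsCompleteCotorsionPair X (XComplex.rightOrth X) →
      XComplex.IsClosedUnderInverseLimits (XComplex.CStar X) →
        ∀ Y : CochainComplex (ModuleCat.{u} R) ℤ,
          (∃ (E : CochainComplex (ModuleCat.{u} R) ℤ) (φ : Y ⟶ E),
            XComplex.IsPreenvelope (XComplex.CInjective X) φ ∧ Mono φ ∧ E.Acyclic ∧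
              XComplex.EpsilonClass (XComplex.XInjective X) E) ∧
          (∃ (P : CochainComplex (ModuleCat.{u} R) ℤ) (φ : P ⟶ Y),
            XComplex.IsPrecover (XComplex.CProjective X) φ ∧ Epi φ ∧ P.Acyclic ∧
              XComplex.EpsilonClass (XComplex.XProjective X) P)) := by
  refine ⟨fun _ hext hcov henv => ⟨fun Y _ => ?_, fun Y _ => ?_⟩, fun hpair hlim Y => ?_⟩
  · obtain ⟨E, φ, hφ, hm, hE, -⟩ := exists_mono_preenvelope hinj (exists_mono_rightOrth hcov) Y
    exact ⟨E, φ, hφ, hm, hE⟩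
  · obtain ⟨P, φ, hφ, hm, hP, -⟩ := exists_epi_precover hproj (exists_epi_leftOrth henv) Y
    exact ⟨P, φ, hφ, hm, hP⟩
  · have hext : X.IsClosedUnderExtensions := ⟨fun hS h₁ h₃ => by
      rw [hpair.left_eq] at h₁ h₃ ⊢
      exact leftOrth_of_shortExact _ hS h₁ h₃⟩
    have hiso : X.IsClosedUnderIsomorphisms := ⟨fun e h => by
      rw [hpair.left_eq] at h ⊢
      exact leftOrth_of_iso _ e h⟩
    have hI (E : ModuleCat.{u} R) (_ : Injective E) : X E :=
      hinj E fun A _ => extOneVanishes_of_injective A E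
    have hall : ∀ M, X M := prop_of_isClosedUnderInverseLimits X
      (isClosedUnderInverseLimits_of_cStar (fun M hM => hI M hM.injective) hlim) hI
    refine ⟨exists_mono_preenvelope hinj hpair.enough_injectives Y,
      exists_epi_precover hproj (fun M => ?_) Y⟩
    -- The kernel lies in `X` because every module does.
    exact ⟨_, _, kernel.ι (Projective.π M), Projective.π M, kernel.condition _,
      { exact := ShortComplex.exact_of_f_is_kernel _ (kernelIsKernel _) },
      fun B _ => extOneVanishes_of_projective _ B, hall _⟩

end
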